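/- Let $d\ge 1$, let $\rho$ be a probability density on $\mathbb{R}^d$ with support $\Omega=\{y:\rho(y)>0\}$, and let $(X,Y)$ be a random vector with values in $\mathbb{R}^d\times\{0,1\}$ such that $X$ has density $\rho$. Fix a regular conditional distribution of $Y$ given $X$, write $f(x)=\mathbb{P}[Y=1\mid X=x]$, let $\sigma(x)\ge 0$ be given by $\sigma^2(x)=\mathbb{E}[|Y-f(X)|^2\mid X=x]$, and for a label $c\in\{0,1\}$ let $\mathcal{R}(c)=\mathcal{R}_x(c)=\mathbb{P}[Y\ne c\mid X=x]$ be its 0-1 risk at $x$. Let $(x_0,y_0),\dots,(x_n,y_n)$ be i.i.d. copies of $(X,Y)$, and let $$\hat f(x)=\sum_{i=0}^n w_i(x)\,y_i,\qquad w_i(x)=\frac{\|x-x_i\|^{-d}}{\sum_{j=0}^n\|x-x_j\|^{-d}}$$ be the Hilbert kernel estimator. Let $F(x)=\theta(f(x)-\tfrac12)$ be the Bayes classifier and $\hat F(x)=\theta(\hat f(x)-\tfrac12)$ the plug-in classifier, where $\theta$ is the Heaviside function ($\theta(t)=0$ for $t<0$, $\theta(t)=1$ for $t>0$, and $\theta(0)\in\{0,1\}$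 is any fixed value). Below, $\mathbb{E}$ is the expectation over the training set $(x_i,y_i)_{0\le i\le n}$. 1. For every $x\in\mathbb{R}^d$, every $n\ge 0$ and every $0<\alpha<1$, $$\mathbb{E}[\mathcal{R}(\hat F(x))]-\mathcal{R}(F(x))\le 2\,|f(x)-\tfrac12|^{1-\alpha}\,\mathbb{E}\big[|\hat f(x)-f(x)|^2\big]^{\alpha/2}.$$ 2. Let $x$ be an interior point of $\Omega$ such that $\sigma(x)>0$ and $\rho$, $\sigma$ and $f$ are continuous at $x$. Then $\mathbb{E}[\mathcal{R}(\hat F(x))]-\mathcal{R}(F(x))\to 0$ as $n\to\infty$. More precisely, for every $\varepsilon>0$ there is $N_{x,\varepsilon}$ such that, for all $n\ge N_{x,\varepsilon}$, $$0\le \mathbb{E}[\mathcal{R}(\hat F(x))]-\mathcal{R}(F(x))\le 2(1+\varepsilon)\frac{\sigma(x)}{\sqrt{\ln n}},$$ and, for all $n\ge N_{x,\varepsilon}$ and all $0<\alpha<1$, $$0\le \mathbb{E}[\mathcal{R}(\hat F(x))]-\mathcal{R}(F(x))\le 2\,|f(x)-\tfrac12|^{1-\alpha}\,(1+\varepsilon)^{\alpha}\,\frac{\sigma^{\alpha}(x)}{(\ln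 n)^{\alpha/2}}.$$ -/

import Mathlib

open MeasureTheory ProbabilityTheory Filter Topology

noncomputable section

namespace HilbertKernel

/-- `ρ` is a probability density on `ℝ^d`. -/
structure IsDensity {d : ℕ} (ρ : EuclideanSpace ℝ (Fin d) → ℝ) : Prop where
  measurable : Measurable ρ
  nonneg : ∀ y, 0 ≤ ρ y
  lintegral_eq_one : ∫⁻ y, ENNReal.ofReal (ρ y) = 1

/-- The support `Ω = {y | ρ y > 0}` of the density. -/
def densitySupport {d : ℕ} (ρ : EuclideanSpace ℝ (Fin d) → ℝ) : Set (EuclideanSpace ℝ (Fin d)) :=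
  {y | 0 < ρ y}

/-- The law of one observation `(X, Y) ∈ ℝ^d × {0, 1}`: `X` has density `ρ`, and `η y` is the
conditional law of `Y` given `X = y`. -/
def jointLaw {d : ℕ} (ρ : EuclideanSpace ℝ (Fin d) → ℝ)
    (η : Kernel (EuclideanSpace ℝ (Fin d)) (Fin 2)) :
    Measure (EuclideanSpace ℝ (Fin d) × Fin 2) :=
  (volume.withDensity fun y => ENNReal.ofReal (ρ y)) ⊗ₘ η

/-- The law of the training set: `n + 1` i.i.d. observations of `(X, Y)`. -/
def sampleLaw {d : ℕ} (ρ : EuclideanSpace ℝ (Fin d) → ℝ)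
    (η : Kernel (EuclideanSpace ℝ (Fin d)) (Fin 2)) (n : ℕ) :
    Measure (Fin (n + 1) → EuclideanSpace ℝ (Fin d) × Fin 2) :=
  Measure.pi fun _ => jointLaw ρ η

/-- The label `0` or `1` as a real number. -/
def labelVal (y : Fin 2) : ℝ := ((y : ℕ) : ℝ)

/-- The regression function `f x = P[Y = 1 | X = x]`. -/
def regFun {d : ℕ} (η : Kernel (EuclideanSpace ℝ (Fin d)) (Fin 2))
    (x : EuclideanSpace ℝ (Fin d)) : ℝ :=
  (η x).real {1}

/-- The conditional standard deviation `σ x`, where `σ² x = E[|Y - f X|² | X = x]`. -/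
def condStd {d : ℕ} (η : Kernel (EuclideanSpace ℝ (Fin d)) (Fin 2))
    (x : EuclideanSpace ℝ (Fin d)) : ℝ :=
  Real.sqrt (∫ y, |labelVal y - regFun η x| ^ 2 ∂(η x))

open Classical in
/-- The Hilbert kernel weights `w_i x = ‖x - x_i‖^(-d) / ∑ j, ‖x - x_j‖^(-d)`. If `x` is itself a
data point, the weights are extended by the interpolation property: all the weight sits, in equal
parts, on the indices `i` with `x_i = x`. -/
def weight {d n : ℕ} (x : EuclideanSpace ℝ (Fin d))
    (xs : Fin (n + 1) → EuclideanSpace ℝ (Fin d)) (i : Fin (n + 1)) : ℝ :=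
  if ∃ j, xs j = x then
    if xs i = x then ((Nat.card {j // xs j = x} : ℕ) : ℝ)⁻¹ else 0
  else ‖x - xs i‖ ^ (-(d : ℤ)) / ∑ j, ‖x - xs j‖ ^ (-(d : ℤ))

/-- The Hilbert kernel estimator `f̂ x = ∑ i, w_i x * y_i`. -/
def estimator {d n : ℕ} (s : Fin (n + 1) → EuclideanSpace ℝ (Fin d) × Fin 2)
    (x : EuclideanSpace ℝ (Fin d)) : ℝ :=
  ∑ i, weight x (fun j => (s j).1) i * labelVal (s i).2

/-- The Heaviside function with values in `{0, 1}` and value `v` at `0`. -/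
def heaviside (v : Fin 2) (t : ℝ) : Fin 2 :=
  if t < 0 then 0 else if t = 0 then v else 1

/-- The Bayes classifier `F x = θ(f x - 1/2)`. -/
def bayesClassifier {d : ℕ} (v : Fin 2) (η : Kernel (EuclideanSpace ℝ (Fin d)) (Fin 2))
    (x : EuclideanSpace ℝ (Fin d)) : Fin 2 :=
  heaviside v (regFun η x - 1 / 2)

/-- The plug-in classifier `F̂ x = θ(f̂ x - 1/2)`. -/
def plugin {d n : ℕ} (v : Fin 2) (s : Fin (n + 1) → EuclideanSpace ℝ (Fin d) × Fin 2)
    (x : EuclideanSpace ℝ (Fin d)) : Fin 2 :=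
  heaviside v (estimator s x - 1 / 2)

/-- The 0-1 risk at `x` of predicting the label `c`, that is `P[Y ≠ c | X = x]`. -/
def risk {d : ℕ} (η : Kernel (EuclideanSpace ℝ (Fin d)) (Fin 2))
    (x : EuclideanSpace ℝ (Fin d)) (c : Fin 2) : ℝ :=
  (η x).real {y | c ≠ y}

/-- The pointwise excess classification risk `E[R(F̂ x)] - R(F x)`, the expectation being over
the training set of size `n + 1`. -/
def excessRisk {d : ℕ} (v : Fin 2) (ρ : EuclideanSpace ℝ (Fin d) → ℝ)
    (η : Kernel (EuclideanSpace ℝ (Fin d)) (Fin 2)) (n : ℕ)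
    (x : EuclideanSpace ℝ (Fin d)) : ℝ :=
  (∫ s, risk η x (plugin v s x) ∂(sampleLaw ρ η n)) - risk η x (bayesClassifier v η x)

/-- The pointwise excess regression risk `E[|f̂ x - f x|²]`. -/
def regressionRisk {d : ℕ} (ρ : EuclideanSpace ℝ (Fin d) → ℝ)
    (η : Kernel (EuclideanSpace ℝ (Fin d)) (Fin 2)) (n : ℕ)
    (x : EuclideanSpace ℝ (Fin d)) : ℝ :=
  ∫ s, |estimator s x - regFun η x| ^ 2 ∂(sampleLaw ρ η n)

end HilbertKernel

end

namespace HilbertKernel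

/-! ### Labels, regression function and the laws of the data -/

variable {d n : ℕ}

/-! Write `D = |f x - 1/2|` and let `P` be the probability that the two classifiers disagree at `x`.
The excess risk is exactly `2 * D * P` (`excessRisk_eq`), and a disagreement forces `|f̂ x - f x| ≥
D`. Markov's inequality for the square gives `D * P ^ (1/2) ≤ E[|f̂ x - f x|²] ^ (1/2)`, and the
factorisation `D * P = D ^ (1 - α) * (D * P ^ (1/α)) ^ α` turns this into the first claim.

For the second claim no sharp asymptotics of the regression risk are needed. The threshold `D` does
not depend on `n`, and it suffices that `D * P = O(1 / log n)`: this is `o(1 / √(log n))`, so it is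
eventually below `(1 + ε) * σ / √(log n)`, whatever the constant.

That rate comes from the tail of `Z = ‖x - X‖ ^ (-d)`, which is of order `1 / t`
(`exists_tail_bounds`). Truncated at level `n + 1`, `Z` has mean at least of order `log n` and
second moment `O(n)`, so Chebyshev's inequality makes the normalisation `∑ Z_i` at least of order `n
log n` up to a small probability. On that event the weight carried by points far from `x` is `O(1 /
log n)`, which controls the bias; the expected sum of squared weights is `O(1 / log n)`, which
controls the noise. -/

lemma labelVal_mem_Icc (y : Fin 2) : labelVal y ∈ Set.Icc (0 : ℝ) 1 := by
  fin_cases y <;> simp [labelVal]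

lemma measurable_labelVal : Measurable labelVal := Measurable.of_discrete

lemma measurable_regFun (η : Kernel (EuclideanSpace ℝ (Fin d)) (Fin 2)) :
    Measurable (regFun η) :=
  (η.measurable_coe (MeasurableSet.singleton 1)).ennreal_toReal

lemma regFun_mem_Icc (η : Kernel (EuclideanSpace ℝ (Fin d)) (Fin 2)) [IsMarkovKernel η]
    (x : EuclideanSpace ℝ (Fin d)) : regFun η x ∈ Set.Icc (0 : ℝ) 1 :=
  ⟨measureReal_nonneg, measureReal_le_one⟩

lemma integral_labelVal (η : Kernel (EuclideanSpace ℝ (Fin d)) (Fin 2)) [IsMarkovKernel η]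
    (x : EuclideanSpace ℝ (Fin d)) : ∫ y, labelVal y ∂(η x) = regFun η x := by
  rw [integral_fintype (Integrable.of_finite)]
  simp [labelVal, regFun]

lemma isProbabilityMeasure_withDensity {ρ : EuclideanSpace ℝ (Fin d) → ℝ} (hρ : IsDensity ρ) :
    IsProbabilityMeasure (volume.withDensity fun y => ENNReal.ofReal (ρ y)) :=
  ⟨by rw [withDensity_apply _ MeasurableSet.univ, Measure.restrict_univ, hρ.lintegral_eq_one]⟩

lemma isProbabilityMeasure_jointLaw {ρ : EuclideanSpace ℝ (Fin d) → ℝ} (hρ : IsDensity ρ)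
    (η : Kernel (EuclideanSpace ℝ (Fin d)) (Fin 2)) [IsMarkovKernel η] :
    IsProbabilityMeasure (jointLaw ρ η) := by
  have := isProbabilityMeasure_withDensity hρ
  unfold jointLaw
  infer_instance

lemma isProbabilityMeasure_sampleLaw {ρ : EuclideanSpace ℝ (Fin d) → ℝ} (hρ : IsDensity ρ)
    (η : Kernel (EuclideanSpace ℝ (Fin d)) (Fin 2)) [IsMarkovKernel η] (n : ℕ) :
    IsProbabilityMeasure (sampleLaw ρ η n) := by
  have := isProbabilityMeasure_jointLaw hρ η
  unfold sampleLaw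
  infer_instance

/-! ### The weights -/

lemma weight_nonneg (x : EuclideanSpace ℝ (Fin d)) (xs : Fin (n + 1) → EuclideanSpace ℝ (Fin d))
    (i : Fin (n + 1)) : 0 ≤ weight x xs i := by
  unfold weight
  split_ifs
  · positivity
  · exact le_rfl
  · exact div_nonneg (by positivity) (Finset.sum_nonneg fun j _ => by positivity)

lemma weight_of_forall_ne {x : EuclideanSpace ℝ (Fin d)}
    {xs : Fin (n + 1) → EuclideanSpace ℝ (Fin d)} (h : ∀ j, xs j ≠ x) (i : Fin (n + 1)) :
    weight x xs i = ‖x - xs i‖ ^ (-(d : ℤ)) / ∑ j, ‖x - xs j‖ ^ (-(d : ℤ)) := by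
  unfold weight
  rw [if_neg (by simpa using h)]

lemma sum_weight (x : EuclideanSpace ℝ (Fin d)) (xs : Fin (n + 1) → EuclideanSpace ℝ (Fin d)) :
    ∑ i, weight x xs i = 1 := by
  classical
  by_cases h : ∃ j, xs j = x
  · simp only [weight, if_pos h]
    rw [Finset.sum_ite, Finset.sum_const, Finset.sum_const_zero, add_zero, nsmul_eq_mul,
      Nat.card_eq_fintype_card, Fintype.card_subtype]
    refine mul_inv_cancel₀ ?_
    obtain ⟨j, hj⟩ := h
    exact Nat.cast_ne_zero.2 (Finset.card_ne_zero_of_mem (a := j) (by simpa using hj))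
  · push Not at h
    simp only [weight_of_forall_ne h]
    rw [← Finset.sum_div]
    refine div_self (Finset.sum_pos (fun j _ => ?_) Finset.univ_nonempty).ne'
    exact zpow_pos (norm_pos_iff.2 (sub_ne_zero.2 (h j).symm)) _

lemma weight_le_one (x : EuclideanSpace ℝ (Fin d))
    (xs : Fin (n + 1) → EuclideanSpace ℝ (Fin d)) (i : Fin (n + 1)) : weight x xs i ≤ 1 := by
  rw [← sum_weight x xs]
  exact Finset.single_le_sum (fun j _ => weight_nonneg x xs j) (Finset.mem_univ i)

lemma measurable_norm_sub_zpow (x : EuclideanSpace ℝ (Fin d)) :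
    Measurable fun y : EuclideanSpace ℝ (Fin d) => ‖x - y‖ ^ (-(d : ℤ)) := by
  simp only [zpow_neg, zpow_natCast]
  fun_prop

lemma measurable_weight (x : EuclideanSpace ℝ (Fin d)) (i : Fin (n + 1)) :
    Measurable fun xs : Fin (n + 1) → EuclideanSpace ℝ (Fin d) => weight x xs i := by
  classical
  have hm (j : Fin (n + 1)) :
      MeasurableSet {xs : Fin (n + 1) → EuclideanSpace ℝ (Fin d) | xs j = x} :=
    measurableSet_eq_fun (by fun_prop) measurable_const
  have hcard (xs : Fin (n + 1) → EuclideanSpace ℝ (Fin d)) :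
      ((Nat.card {j // xs j = x} : ℕ) : ℝ) = ∑ j, if xs j = x then 1 else 0 := by
    rw [Nat.card_eq_fintype_card, Fintype.card_subtype]
    simp
  unfold weight
  refine Measurable.ite ?_ (Measurable.ite (hm i) ?_ measurable_const) ?_
  · simpa only [Set.ofPred_exists] using MeasurableSet.iUnion hm
  · simp only [hcard]
    exact (Finset.measurable_sum _ fun j _ =>
      Measurable.ite (hm j) measurable_const measurable_const).inv
  · have h (j : Fin (n + 1)) := (measurable_norm_sub_zpow x).comp
      (measurable_pi_apply (X := fun _ : Fin (n + 1) => EuclideanSpace ℝ (Fin d)) j)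
    exact (h i).div (Finset.measurable_sum _ fun j _ => h j)

lemma measurable_weight_fst (x : EuclideanSpace ℝ (Fin d)) (i : Fin (n + 1)) :
    Measurable fun s : Fin (n + 1) → EuclideanSpace ℝ (Fin d) × Fin 2 =>
      weight x (fun j => (s j).1) i :=
  (measurable_weight x i).comp (by fun_prop)

lemma measurable_estimator (x : EuclideanSpace ℝ (Fin d)) :
    Measurable fun s : Fin (n + 1) → EuclideanSpace ℝ (Fin d) × Fin 2 => estimator s x := by
  unfold estimator
  exact Finset.measurable_sum _ fun i _ => (measurable_weight_fst x i).mul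
    (measurable_labelVal.comp (by fun_prop))

lemma estimator_mem_Icc (s : Fin (n + 1) → EuclideanSpace ℝ (Fin d) × Fin 2)
    (x : EuclideanSpace ℝ (Fin d)) : estimator s x ∈ Set.Icc (0 : ℝ) 1 := by
  constructor
  · exact Finset.sum_nonneg fun i _ => mul_nonneg (weight_nonneg _ _ _) (labelVal_mem_Icc _).1
  · rw [← sum_weight x fun j => (s j).1]
    exact Finset.sum_le_sum fun i _ =>
      mul_le_of_le_one_right (weight_nonneg _ _ _) (labelVal_mem_Icc _).2

lemma measurable_heaviside (v : Fin 2) : Measurable (heaviside v) := by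
  unfold heaviside
  exact Measurable.ite measurableSet_Iio measurable_const
    (Measurable.ite (MeasurableSet.singleton 0) measurable_const measurable_const)

lemma measurable_plugin (v : Fin 2) (x : EuclideanSpace ℝ (Fin d)) :
    Measurable fun s : Fin (n + 1) → EuclideanSpace ℝ (Fin d) × Fin 2 => plugin v s x :=
  (measurable_heaviside v).comp ((measurable_estimator x).sub_const _)

/-! ### The classification risk -/

lemma risk_eq (η : Kernel (EuclideanSpace ℝ (Fin d)) (Fin 2)) [IsMarkovKernel η]
    (x : EuclideanSpace ℝ (Fin d)) (c : Fin 2) :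
    risk η x c = if c = 0 then regFun η x else 1 - regFun η x := by
  have h : {y : Fin 2 | c ≠ y} = {c}ᶜ := by ext; simp [eq_comm]
  have h1 : ({0}ᶜ : Set (Fin 2)) = {1} := by ext y; fin_cases y <;> simp
  rw [risk, h]
  fin_cases c
  · simp [h1, regFun]
  · simp [probReal_compl_eq_one_sub, regFun]

lemma risk_sub_risk_bayesClassifier (v : Fin 2)
    (η : Kernel (EuclideanSpace ℝ (Fin d)) (Fin 2)) [IsMarkovKernel η]
    (x : EuclideanSpace ℝ (Fin d)) (c : Fin 2) :
    risk η x c - risk η x (bayesClassifier v η x) =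
      if c ≠ bayesClassifier v η x then 2 * |regFun η x - 1 / 2| else 0 := by
  rw [risk_eq, risk_eq]
  rcases lt_trichotomy (regFun η x - 1 / 2) 0 with h | h | h
  · have hb : bayesClassifier v η x = 0 := by simp only [bayesClassifier, heaviside, if_pos h]
    rw [hb, abs_of_neg h]
    fin_cases c
    · simp
    · simp; ring
  · have : regFun η x = 1 / 2 := by linarith
    rw [this]
    norm_num
  · have hb : bayesClassifier v η x = 1 := by
      simp only [bayesClassifier, heaviside, if_neg h.not_gt, if_neg h.ne']
    rw [hb, abs_of_pos h]
    fin_cases c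
    · simp; ring
    · simp

/-- An estimator closer to `f x` than `1/2` is lies strictly on the same side of `1/2`. The value
`v` at the jump plays no role, since for `f x = 1/2` the bound is trivial. -/
lemma abs_regFun_sub_half_le_of_plugin_ne {v : Fin 2}
    {η : Kernel (EuclideanSpace ℝ (Fin d)) (Fin 2)} {x : EuclideanSpace ℝ (Fin d)}
    {s : Fin (n + 1) → EuclideanSpace ℝ (Fin d) × Fin 2}
    (h : plugin v s x ≠ bayesClassifier v η x) :
    |regFun η x - 1 / 2| ≤ |estimator s x - regFun η x| := by
  contrapose! h
  unfold plugin bayesClassifier heaviside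
  rcases lt_trichotomy (regFun η x - 1 / 2) 0 with h1 | h1 | h1
  · rw [abs_of_neg h1, abs_lt] at h
    rw [if_pos h1, if_pos (by linarith)]
  · rw [h1, abs_zero] at h
    exact absurd h (abs_nonneg _).not_gt
  · rw [abs_of_pos h1, abs_lt] at h
    have h2 : 0 < estimator s x - 1 / 2 := by linarith
    rw [if_neg h1.not_gt, if_neg h1.ne', if_neg h2.not_gt, if_neg h2.ne.symm]

/-- The excess risk is `2 |f x - 1/2|` times the probability that the classifiers disagree. -/
lemma excessRisk_eq (v : Fin 2) {ρ : EuclideanSpace ℝ (Fin d) → ℝ} (hρ : IsDensity ρ)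
    (η : Kernel (EuclideanSpace ℝ (Fin d)) (Fin 2)) [IsMarkovKernel η] (n : ℕ)
    (x : EuclideanSpace ℝ (Fin d)) :
    excessRisk v ρ η n x = 2 * |regFun η x - 1 / 2| *
      (sampleLaw ρ η n).real {s | plugin v s x ≠ bayesClassifier v η x} := by
  have := isProbabilityMeasure_sampleLaw hρ η n
  have hm : Measurable fun s : Fin (n + 1) → EuclideanSpace ℝ (Fin d) × Fin 2 =>
      risk η x (plugin v s x) :=
    (Measurable.of_discrete (f := risk η x)).comp (measurable_plugin v x)
  have hi : Integrable (fun s => risk η x (plugin v s x)) (sampleLaw ρ η n) :=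
    Integrable.of_bound hm.aestronglyMeasurable 1 (Eventually.of_forall fun s => by
      rw [risk, Real.norm_of_nonneg measureReal_nonneg]
      exact measureReal_le_one)
  have hs : MeasurableSet {s : Fin (n + 1) → EuclideanSpace ℝ (Fin d) × Fin 2 |
      plugin v s x ≠ bayesClassifier v η x} :=
    measurable_plugin v x (MeasurableSet.of_discrete (s := {c | c ≠ bayesClassifier v η x}))
  have h : excessRisk v ρ η n x =
      ∫ s, (risk η x (plugin v s x) - risk η x (bayesClassifier v η x)) ∂(sampleLaw ρ η n) := by
    rw [integral_sub hi (integrable_const _)]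
    simp [excessRisk]
  have h' (s : Fin (n + 1) → EuclideanSpace ℝ (Fin d) × Fin 2) :
      risk η x (plugin v s x) - risk η x (bayesClassifier v η x) =
      Set.indicator {s | plugin v s x ≠ bayesClassifier v η x}
        (fun _ => 2 * |regFun η x - 1 / 2|) s := by
    rw [risk_sub_risk_bayesClassifier, Set.indicator_apply]
    rfl
  simp only [h, h']
  rw [integral_indicator_const _ hs, smul_eq_mul, mul_comm]

lemma excessRisk_nonneg (v : Fin 2) {ρ : EuclideanSpace ℝ (Fin d) → ℝ} (hρ : IsDensity ρ)
    (η : Kernel (EuclideanSpace ℝ (Fin d)) (Fin 2)) [IsMarkovKernel η] (n : ℕ)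
    (x : EuclideanSpace ℝ (Fin d)) : 0 ≤ excessRisk v ρ η n x := by
  rw [excessRisk_eq v hρ]
  positivity

/-- Interpolation step shared by both claims: `q` is the root of the regression risk in the first
and `(1 + ε) * σ / √(log n)` in the second. -/
lemma excessRisk_le_of_measureReal_le (v : Fin 2) {ρ : EuclideanSpace ℝ (Fin d) → ℝ}
    (hρ : IsDensity ρ) (η : Kernel (EuclideanSpace ℝ (Fin d)) (Fin 2)) [IsMarkovKernel η] (n : ℕ)
    {x : EuclideanSpace ℝ (Fin d)} {q α : ℝ} (hα : 0 < α)
    (h : |regFun η x - 1 / 2| *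
      (sampleLaw ρ η n).real {s | plugin v s x ≠ bayesClassifier v η x} ^ (1 / α) ≤ q) :
    excessRisk v ρ η n x ≤ 2 * |regFun η x - 1 / 2| ^ (1 - α) * q ^ α := by
  set D := |regFun η x - 1 / 2| with hD
  rw [excessRisk_eq v hρ, ← hD, mul_assoc, mul_assoc]
  set P := (sampleLaw ρ η n).real {s | plugin v s x ≠ bayesClassifier v η x} with hP
  have hP0 : 0 ≤ P := measureReal_nonneg
  have hD0 : 0 ≤ D := abs_nonneg _
  refine mul_le_mul_of_nonneg_left ?_ zero_le_two
  -- Also valid for `D = 0`, because the exponents `1 - α` and `α` add up to `1 ≠ 0`.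
  have h1 : D * P = D ^ (1 - α) * (D * P ^ (1 / α)) ^ α := by
    rw [Real.mul_rpow hD0 (by positivity), ← Real.rpow_mul hP0, one_div_mul_cancel hα.ne',
      Real.rpow_one, ← mul_assoc, ← Real.rpow_add' hD0 (by simp)]
    simp
  rw [h1]
  gcongr

theorem excessRisk_le_regressionRisk (v : Fin 2) {ρ : EuclideanSpace ℝ (Fin d) → ℝ}
    (hρ : IsDensity ρ) (η : Kernel (EuclideanSpace ℝ (Fin d)) (Fin 2)) [IsMarkovKernel η] (n : ℕ)
    (x : EuclideanSpace ℝ (Fin d)) {α : ℝ} (hα : 0 < α) (hα1 : α < 1) :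
    excessRisk v ρ η n x ≤
      2 * |regFun η x - 1 / 2| ^ (1 - α) * regressionRisk ρ η n x ^ (α / 2) := by
  have := isProbabilityMeasure_sampleLaw hρ η n
  have hR : 0 ≤ regressionRisk ρ η n x := integral_nonneg fun s => by positivity
  have key := excessRisk_le_of_measureReal_le v hρ η n (x := x)
    (q := regressionRisk ρ η n x ^ (1 / 2 : ℝ)) hα ?_
  · rwa [← Real.rpow_mul hR, show (1 / 2 : ℝ) * α = α / 2 by ring] at key
  set P := (sampleLaw ρ η n).real {s | plugin v s x ≠ bayesClassifier v η x} with hP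
  set D := |regFun η x - 1 / 2| with hD
  have hP0 : 0 ≤ P := measureReal_nonneg
  have hP1 : P ≤ 1 := measureReal_le_one
  have hD0 : 0 ≤ D := abs_nonneg _
  have hi : Integrable (fun s => |estimator s x - regFun η x| ^ 2) (sampleLaw ρ η n) := by
    refine Integrable.of_bound (C := 1) ?_ (Eventually.of_forall fun s => ?_)
    · have := measurable_estimator (n := n) x
      exact Measurable.aestronglyMeasurable (by fun_prop)
    · obtain ⟨h1, h2⟩ := estimator_mem_Icc s x
      obtain ⟨h3, h4⟩ := regFun_mem_Icc η x
      rw [Real.norm_of_nonneg (by positivity), sq_abs]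
      nlinarith
  have hmarkov : D ^ 2 * P ≤ regressionRisk ρ η n x := by
    refine le_trans ?_ (mul_meas_ge_le_integral_of_nonneg
      (Eventually.of_forall fun s => by positivity) hi (D ^ 2))
    refine mul_le_mul_of_nonneg_left (measureReal_mono fun s hs => ?_) (by positivity)
    exact pow_le_pow_left₀ hD0 (abs_regFun_sub_half_le_of_plugin_ne hs) 2
  -- As `P ≤ 1` and `1 / α ≥ 1 / 2`, Markov's bound at exponent `1 / 2` is enough for every `α`.
  calc D * P ^ (1 / α) ≤ D * P ^ (1 / 2 : ℝ) := by
        refine mul_le_mul_of_nonneg_left ?_ hD0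
        refine Real.rpow_le_rpow_of_exponent_ge_of_imp hP0 hP1 ?_ (fun _ h => absurd h (one_div_pos.2 hα).ne')
        rw [div_le_div_iff₀ two_pos hα]
        linarith
    _ = (D ^ 2 * P) ^ (1 / 2 : ℝ) := by
        rw [Real.mul_rpow (by positivity) hP0, ← Real.sqrt_eq_rpow (D ^ 2), Real.sqrt_sq hD0]
    _ ≤ _ := by gcongr

/-! ### Truncated moments and sums of variables with tail of order `1 / t` -/

section HeavyTail

variable {𝓧 : Type*} [MeasurableSpace 𝓧] {ν : Measure 𝓧} [IsProbabilityMeasure ν] {Z : 𝓧 → ℝ}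

lemma memLp_min_const (hZ : Measurable Z) (hZ0 : ∀ y, 0 ≤ Z y) {M : ℝ} (hM : 0 ≤ M)
    (p : ENNReal) : MemLp (fun y => min (Z y) M) p ν :=
  MemLp.of_bound (by fun_prop) M (Eventually.of_forall fun y => by
    rw [Real.norm_of_nonneg (le_min (hZ0 y) hM)]
    exact min_le_right _ _)

/-- The truncated second moment of a variable with tail `P[Z > t] ≤ C / t`. -/
lemma integral_min_sq_le (hZ : Measurable Z) (hZ0 : ∀ y, 0 ≤ Z y) {C M : ℝ} (hC : 0 ≤ C)
    (hM : 0 ≤ M) (htail : ∀ t, 0 < t → ν.real {y | t < Z y} ≤ C / t) :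
    ∫ y, min (Z y) M ^ 2 ∂ν ≤ 2 * C * M := by
  have hm : Measurable fun y => min (Z y) M := by fun_prop
  have h0 (y : 𝓧) : 0 ≤ min (Z y) M := le_min (hZ0 y) hM
  rw [integral_eq_lintegral_of_nonneg_ae (Eventually.of_forall fun y => by positivity)
    (by fun_prop)]
  refine ENNReal.toReal_le_of_le_ofReal (by positivity) ?_
  -- Layer cake: `E[min(Z, M)²] = 2 ∫ t P[min(Z, M) > t] dt`. The integrand is at most `C` for `t <
  -- M` and vanishes beyond.
  have key := lintegral_rpow_eq_lintegral_meas_lt_mul ν (Eventually.of_forall h0)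
    hm.aemeasurable (p := 2) two_pos
  simp only [Real.rpow_two] at key
  rw [key, mul_assoc, ENNReal.ofReal_mul zero_le_two]
  refine mul_le_mul_right ?_ _
  calc ∫⁻ t in Set.Ioi 0, ν {y | t < min (Z y) M} * ENNReal.ofReal (t ^ (2 - 1 : ℝ))
      ≤ ∫⁻ t in Set.Ioi 0, (Set.Ioo 0 M).indicator (fun _ => ENNReal.ofReal C) t := by
        refine setLIntegral_mono' measurableSet_Ioi fun t (ht : 0 < t) => ?_
        by_cases htM : t < M
        · rw [Set.indicator_of_mem (Set.mem_Ioo.2 ⟨ht, htM⟩)]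
          have h1 : ν {y | t < min (Z y) M} ≤ ENNReal.ofReal (C / t) := by
            rw [← ofReal_measureReal]
            refine ENNReal.ofReal_le_ofReal ((measureReal_mono fun y hy => ?_).trans (htail t ht))
            exact lt_of_lt_of_le (b := min (Z y) M) hy (min_le_left _ _)
          calc _ ≤ ENNReal.ofReal (C / t) * ENNReal.ofReal (t ^ (2 - 1 : ℝ)) := by gcongr
            _ = ENNReal.ofReal C := by
              rw [← ENNReal.ofReal_mul (by positivity)]
              norm_num [ht.ne']
        · have : {y | t < min (Z y) M} = ∅ := by
            ext y
            simp [htM]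
          rw [this, measure_empty, zero_mul]
          exact zero_le
    _ ≤ ∫⁻ t, (Set.Ioo 0 M).indicator (fun _ => ENNReal.ofReal C) t :=
        setLIntegral_le_lintegral _ _
    _ = ENNReal.ofReal (C * M) := by
        rw [lintegral_indicator_const measurableSet_Ioo, Real.volume_Ioo, sub_zero,
          ENNReal.ofReal_mul hC]

/-- The truncated mean of a variable with tail `P[Z > t] ≥ c / t` for `t ≥ t₀`. -/
lemma mul_log_le_integral_min (hZ : Measurable Z) (hZ0 : ∀ y, 0 ≤ Z y) {c t₀ M : ℝ} (hc : 0 ≤ c)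
    (ht₀ : 0 < t₀) (hM : t₀ ≤ M) (htail : ∀ t, t₀ ≤ t → c / t ≤ ν.real {y | t < Z y}) :
    c * Real.log (M / t₀) ≤ ∫ y, min (Z y) M ∂ν := by
  have hM0 : 0 < M := ht₀.trans_le hM
  have hm : Measurable fun y => min (Z y) M := by fun_prop
  have h0 (y : 𝓧) : 0 ≤ min (Z y) M := le_min (hZ0 y) hM0.le
  have hi : Integrable (fun y => min (Z y) M) ν :=
    memLp_one_iff_integrable.1 (memLp_min_const hZ hZ0 hM0.le 1)
  rw [← ENNReal.ofReal_le_ofReal_iff (integral_nonneg h0),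
    ofReal_integral_eq_lintegral_ofReal hi (Eventually.of_forall h0),
    lintegral_eq_lintegral_meas_lt ν (Eventually.of_forall h0) hm.aemeasurable]
  have hint : ∫ t in Set.Ioo t₀ M, c * t⁻¹ = c * Real.log (M / t₀) := by
    rw [← integral_inv_of_pos ht₀ hM0, ← integral_Ioc_eq_integral_Ioo,
      ← intervalIntegral.integral_of_le hM, intervalIntegral.integral_const_mul]
  have hint' : IntegrableOn (fun t : ℝ => c * t⁻¹) (Set.Ioo t₀ M) := by
    refine IntegrableOn.mono_set (t := Set.Icc t₀ M) ?_ Set.Ioo_subset_Icc_self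
    refine ContinuousOn.integrableOn_Icc ?_
    exact continuousOn_const.mul (continuousOn_inv₀.mono fun t ht => (ht₀.trans_le ht.1).ne')
  rw [← hint, ofReal_integral_eq_lintegral_ofReal hint' ?_]
  · calc ∫⁻ t in Set.Ioo t₀ M, ENNReal.ofReal (c * t⁻¹)
        ≤ ∫⁻ t in Set.Ioo t₀ M, ν {y | t < min (Z y) M} := by
          refine setLIntegral_mono' measurableSet_Ioo fun t ht => ?_
          rw [← ofReal_measureReal]
          refine ENNReal.ofReal_le_ofReal ((htail t ht.1.le).trans (measureReal_mono fun y hy => ?_))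
          exact lt_min hy ht.2
      _ ≤ _ := lintegral_mono_set fun t ht => ht₀.trans ht.1
  · refine (ae_restrict_iff' measurableSet_Ioo).2 (Eventually.of_forall fun t ht => ?_)
    have := ht₀.trans ht.1
    simp only [Pi.zero_apply]
    positivity

/-- A sum of independent heavy-tailed nonnegative variables is unlikely to be less than half of the
truncated mean. -/
lemma pi_measureReal_sum_lt_le {ι : Type*} [Fintype ι] [Nonempty ι] (hZ : Measurable Z)
    (hZ0 : ∀ y, 0 ≤ Z y) {C M b : ℝ} (hC : 0 ≤ C) (hM : 0 ≤ M) (hb : 0 < b)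
    (htail : ∀ t, 0 < t → ν.real {y | t < Z y} ≤ C / t) (hmean : b ≤ ∫ y, min (Z y) M ∂ν) :
    (Measure.pi fun _ : ι => ν).real {s | ∑ i, Z (s i) < (Fintype.card ι : ℝ) * b / 2} ≤
      8 * C * M / ((Fintype.card ι : ℝ) * b ^ 2) := by
  set m : ℝ := (Fintype.card ι : ℝ) with hm
  have hm0 : 0 < m := by rw [hm]; exact Nat.cast_pos.2 Fintype.card_pos
  set X : ι → 𝓧 → ℝ := fun _ y => min (Z y) M with hX
  have hL (i : ι) : MemLp (X i) 2 ν := memLp_min_const hZ hZ0 hM 2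
  have hLi (i : ι) : MemLp (fun s : ι → 𝓧 => X i (s i)) 2 (Measure.pi fun _ : ι => ν) :=
    (hL i).comp_measurePreserving (measurePreserving_eval _ i)
  have hvar := variance_sum_pi (μ := fun _ : ι => ν) hL
  have hvar_le : Var[∑ i, fun s : ι → 𝓧 => X i (s i); Measure.pi fun _ : ι => ν] ≤
      m * (2 * C * M) := by
    rw [hvar]
    calc ∑ i, Var[X i; ν] ≤ ∑ _i : ι, 2 * C * M := Finset.sum_le_sum fun i _ =>
          (variance_le_expectation_sq (hL i).aestronglyMeasurable).trans
            (integral_min_sq_le hZ hZ0 hC hM htail)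
      _ = _ := by simp [hm]
  have hE : ∫ s, (∑ i, fun s : ι → 𝓧 => X i (s i)) s ∂(Measure.pi fun _ : ι => ν) =
      m * ∫ y, min (Z y) M ∂ν := by
    simp only [Finset.sum_apply]
    rw [integral_finsetSum _ fun i _ => (hLi i).integrable one_le_two]
    simp only [integral_comp_eval (μ := fun _ : ι => ν) (hL _).aestronglyMeasurable]
    simp [hX, hm]
  -- The truncated sum has mean at least `m * b` and is dominated by `∑ Z`, so `∑ Z < m * b / 2`
  -- forces it to deviate from its mean by at least `m * b / 2`.
  have hcheb := meas_ge_le_variance_div_sq (memLp_finsetSum' Finset.univ fun i _ => hLi i)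
    (c := m * b / 2) (by positivity)
  rw [hE] at hcheb
  have hcheb' := ENNReal.toReal_le_of_le_ofReal
    (div_nonneg (variance_nonneg _ _) (by positivity)) hcheb
  refine (measureReal_mono fun s hs => ?_).trans (hcheb'.trans ?_)
  · have hs' : ∑ i, Z (s i) < m * b / 2 := hs
    have h1 : (∑ i, fun s : ι → 𝓧 => X i (s i)) s ≤ ∑ i, Z (s i) := by
      rw [Finset.sum_apply]
      exact Finset.sum_le_sum fun i _ => min_le_left _ _
    have h2 : m * b ≤ m * ∫ y, min (Z y) M ∂ν := by gcongr
    change m * b / 2 ≤ |_|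
    rw [abs_sub_comm]
    exact le_trans (by linarith) (le_abs_self _)
  · calc _ ≤ m * (2 * C * M) / (m * b / 2) ^ 2 := by gcongr
      _ = _ := by field_simp; ring

end HeavyTail

/-! ### Orthogonality of the noise and the sum of squared weights -/

/-- The noise `y - f x` of an observation `(x, y)`. -/
noncomputable def noise (η : Kernel (EuclideanSpace ℝ (Fin d)) (Fin 2))
    (z : EuclideanSpace ℝ (Fin d) × Fin 2) : ℝ :=
  labelVal z.2 - regFun η z.1

lemma measurable_noise (η : Kernel (EuclideanSpace ℝ (Fin d)) (Fin 2)) :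
    Measurable (noise η) :=
  (measurable_labelVal.comp measurable_snd).sub ((measurable_regFun η).comp measurable_fst)

lemma abs_noise_le_one (η : Kernel (EuclideanSpace ℝ (Fin d)) (Fin 2)) [IsMarkovKernel η]
    (z : EuclideanSpace ℝ (Fin d) × Fin 2) : |noise η z| ≤ 1 := by
  have h1 := labelVal_mem_Icc z.2
  have h2 := regFun_mem_Icc η z.1
  rw [noise, abs_le]
  constructor <;> linarith [h1.1, h1.2, h2.1, h2.2]

lemma integral_noise (η : Kernel (EuclideanSpace ℝ (Fin d)) (Fin 2)) [IsMarkovKernel η]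
    (a : EuclideanSpace ℝ (Fin d)) : ∫ b, noise η (a, b) ∂(η a) = 0 := by
  simp only [noise]
  rw [integral_sub Integrable.of_finite (integrable_const _), integral_labelVal]
  simp

/-- The noise of the `i`-th observation is orthogonal to every bounded function of the sample that
does not depend on the `i`-th label. -/
lemma integral_mul_noise_eq_zero {ρ : EuclideanSpace ℝ (Fin d) → ℝ} (hρ : IsDensity ρ)
    (η : Kernel (EuclideanSpace ℝ (Fin d)) (Fin 2)) [IsMarkovKernel η] (i : Fin (n + 1))
    {G : (Fin (n + 1) → EuclideanSpace ℝ (Fin d) × Fin 2) → ℝ} (hG : Measurable G)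
    (hG1 : ∀ s, |G s| ≤ 1)
    (hGi : ∀ a b b' t, G (i.insertNth (a, b) t) = G (i.insertNth (a, b') t)) :
    ∫ s, G s * noise η (s i) ∂(sampleLaw ρ η n) = 0 := by
  have := isProbabilityMeasure_jointLaw hρ η
  have := isProbabilityMeasure_withDensity hρ
  have mp := (measurePreserving_piFinSuccAbove
    (fun _ : Fin (n + 1) => jointLaw ρ η) i).symm
  have hnoise := measurable_noise η
  have hF : Measurable fun s : Fin (n + 1) → EuclideanSpace ℝ (Fin d) × Fin 2 =>
      G s * noise η (s i) := by fun_prop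
  have hF1 (s : Fin (n + 1) → EuclideanSpace ℝ (Fin d) × Fin 2) :
      ‖G s * noise η (s i)‖ ≤ 1 := by
    rw [norm_mul]
    exact mul_le_one₀ (hG1 s) (norm_nonneg _) (abs_noise_le_one η _)
  -- Split off the `i`-th observation and integrate over it first: with its position and all other
  -- data fixed, `G` is constant in the label and the noise has conditional mean zero.
  rw [sampleLaw, ← mp.integral_comp', integral_prod_symm]
  · refine integral_eq_zero_of_ae (Eventually.of_forall fun t => ?_)
    let I : EuclideanSpace ℝ (Fin d) × Fin 2 → Fin (n + 1) → EuclideanSpace ℝ (Fin d) × Fin 2 :=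
      fun z => i.insertNth z t
    have hI (z) : I z i = z := Fin.insertNth_apply_same _ _ _
    change ∫ z, G (I z) * noise η (I z i) ∂(jointLaw ρ η) = 0
    simp only [hI, jointLaw]
    rw [Measure.integral_compProd]
    · refine integral_eq_zero_of_ae (Eventually.of_forall fun a => ?_)
      have h (b : Fin 2) : G (I (a, b)) = G (I (a, 0)) := hGi a b 0 t
      simp only [h, integral_const_mul, integral_noise, mul_zero, Pi.zero_apply]
    · refine Integrable.of_bound ?_ 1 (Eventually.of_forall fun z => ?_)
      · have h := hF.comp ((MeasurableEquiv.piFinSuccAbove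
          (fun _ : Fin (n + 1) => EuclideanSpace ℝ (Fin d) × Fin 2) i).symm.measurable.comp
            (measurable_id.prodMk (measurable_const (a := t))))
        refine Measurable.aestronglyMeasurable ?_
        convert h using 2 with z
        change _ = G (I z) * noise η (I z i)
        rw [hI]
      · simpa only [hI] using hF1 (I z)
  · exact Integrable.of_bound (hF.comp (MeasurableEquiv.measurable _)).aestronglyMeasurable 1
      (Eventually.of_forall fun z => hF1 _)

/-- The conditional variance bound: `E[(∑ i, w_i (y_i - f x_i))²] ≤ E[∑ i, w_i²]`. -/
lemma integral_sum_weight_mul_noise_sq_le {ρ : EuclideanSpace ℝ (Fin d) → ℝ} (hρ : IsDensity ρ)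
    (η : Kernel (EuclideanSpace ℝ (Fin d)) (Fin 2)) [IsMarkovKernel η]
    (x : EuclideanSpace ℝ (Fin d)) :
    ∫ s, (∑ i, weight x (fun j => (s j).1) i * noise η (s i)) ^ 2 ∂(sampleLaw ρ η n) ≤
      ∫ s, ∑ i, weight x (fun j => (s j).1) i ^ 2 ∂(sampleLaw ρ η n) := by
  have := isProbabilityMeasure_sampleLaw hρ η n
  have hnoise := measurable_noise η
  have hw (i : Fin (n + 1)) := measurable_weight_fst x i
  set W : Fin (n + 1) → (Fin (n + 1) → EuclideanSpace ℝ (Fin d) × Fin 2) → ℝ :=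
    fun i s => weight x (fun j => (s j).1) i with hW
  have hw1 (i s) : |W i s| ≤ 1 := by
    rw [abs_of_nonneg (weight_nonneg _ _ _)]
    exact weight_le_one _ _ _
  have hb (i j : Fin (n + 1)) (s) : |W i s * W j s * noise η (s j)| ≤ 1 := by
    rw [abs_mul, abs_mul]
    exact mul_le_one₀ (mul_le_one₀ (hw1 i s) (abs_nonneg _) (hw1 j s)) (abs_nonneg _)
      (abs_noise_le_one η _)
  have hm (i j : Fin (n + 1)) : Measurable fun s => W i s * W j s * noise η (s j) :=
    ((hw i).mul (hw j)).mul (hnoise.comp (measurable_pi_apply j))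
  have hi (i j : Fin (n + 1)) : Integrable
      (fun s => W i s * W j s * noise η (s j) * noise η (s i)) (sampleLaw ρ η n) := by
    refine Integrable.of_bound
      ((hm i j).mul (hnoise.comp (measurable_pi_apply i))).aestronglyMeasurable 1
      (Eventually.of_forall fun s => ?_)
    rw [norm_mul]
    exact mul_le_one₀ (hb i j s) (norm_nonneg _) (abs_noise_le_one η _)
  have hi2 (i : Fin (n + 1)) : Integrable (fun s => W i s ^ 2) (sampleLaw ρ η n) := by
    refine Integrable.of_bound ((hw i).pow_const 2).aestronglyMeasurable 1
      (Eventually.of_forall fun s => ?_)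
    rw [norm_pow]
    exact pow_le_one₀ (norm_nonneg _) (hw1 i s)
  have hexp (s) : (∑ i, W i s * noise η (s i)) ^ 2 =
      ∑ i, ∑ j, W i s * W j s * noise η (s j) * noise η (s i) := by
    rw [sq, Finset.sum_mul_sum]
    exact Finset.sum_congr rfl fun i _ => Finset.sum_congr rfl fun j _ => by ring
  change ∫ s, (∑ i, W i s * noise η (s i)) ^ 2 ∂_ ≤ ∫ s, ∑ i, W i s ^ 2 ∂_
  simp only [hexp]
  rw [integral_finsetSum _ fun i _ => integrable_finsetSum _ fun j _ => hi i j,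
    integral_finsetSum _ fun i _ => hi2 i]
  refine Finset.sum_le_sum fun i _ => ?_
  rw [integral_finsetSum _ fun j _ => hi i j, Finset.sum_eq_single i]
  · refine integral_mono (hi i i) (hi2 i) fun s => ?_
    have h1 : noise η (s i) ^ 2 ≤ 1 := (sq_le_one_iff_abs_le_one _).2 (abs_noise_le_one η _)
    calc W i s * W i s * noise η (s i) * noise η (s i) = W i s ^ 2 * noise η (s i) ^ 2 := by ring
      _ ≤ W i s ^ 2 := mul_le_of_le_one_right (sq_nonneg _) h1
  -- The cross terms vanish: the weights see only positions and the `j`-th noise does not involve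
  -- the `i`-th observation, so `W i * W j * noise j` is an admissible `G`.
  · intro j _ hji
    obtain ⟨k, rfl⟩ := Fin.exists_succAbove_eq hji
    refine integral_mul_noise_eq_zero hρ η i (hm i _) (hb i _) fun a b b' t => ?_
    have h : (fun l => (i.insertNth (α := fun _ => EuclideanSpace ℝ (Fin d) × Fin 2)
        (a, b) t l).1) = fun l => (i.insertNth (α := fun _ => EuclideanSpace ℝ (Fin d) × Fin 2)
        (a, b') t l).1 := by
      funext l
      refine Fin.succAboveCases i ?_ (fun l => ?_) l <;> simp
    simp only [hW, h, Fin.insertNth_apply_succAbove]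
  · simp

/-- If the sum of the unnormalised weights is at least `A` with high probability, the expected sum
of the squares of the weights is small. -/
lemma integral_sum_weight_sq_le {ρ : EuclideanSpace ℝ (Fin d) → ℝ} (hρ : IsDensity ρ)
    (η : Kernel (EuclideanSpace ℝ (Fin d)) (Fin 2)) [IsMarkovKernel η]
    (x : EuclideanSpace ℝ (Fin d)) (hx : ∀ᵐ z ∂(jointLaw ρ η), z.1 ≠ x) {A C : ℝ} (hA : 0 < A)
    (hC : 0 ≤ C)
    (htail : ∀ t, 0 < t → (jointLaw ρ η).real {z | t < ‖x - z.1‖ ^ (-(d : ℤ))} ≤ C / t) :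
    ∫ s, ∑ i, weight x (fun j => (s j).1) i ^ 2 ∂(sampleLaw ρ η n) ≤
      (sampleLaw ρ η n).real {s | ∑ i, ‖x - (s i).1‖ ^ (-(d : ℤ)) < A} +
        (n + 1) * (2 * C / A) := by
  have := isProbabilityMeasure_jointLaw hρ η
  have := isProbabilityMeasure_sampleLaw hρ η n
  set Z : EuclideanSpace ℝ (Fin d) × Fin 2 → ℝ := fun z => ‖x - z.1‖ ^ (-(d : ℤ)) with hZdef
  have hZ : Measurable Z := (measurable_norm_sub_zpow x).comp measurable_fst
  have hZ0 (z) : 0 ≤ Z z := by positivity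
  set T : Set (Fin (n + 1) → EuclideanSpace ℝ (Fin d) × Fin 2) := {s | ∑ i, Z (s i) < A} with hT
  have hTm : MeasurableSet T := measurableSet_lt
    (Finset.measurable_sum _ fun i _ => hZ.comp (measurable_pi_apply i)) measurable_const
  have hx' : ∀ᵐ s ∂(sampleLaw ρ η n), ∀ j, (s j).1 ≠ x := by
    rw [ae_all_iff]
    exact fun j => (measurePreserving_eval (fun _ : Fin (n + 1) =>
      jointLaw ρ η) j).quasiMeasurePreserving.ae hx
  have hL : Integrable (fun z => min (Z z) A ^ 2) (jointLaw ρ η) :=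
    (memLp_min_const hZ hZ0 hA.le 2).integrable_sq
  have hLi (i : Fin (n + 1)) :
      Integrable (fun s => min (Z (s i)) A ^ 2 / A ^ 2) (sampleLaw ρ η n) :=
    ((measurePreserving_eval (fun _ : Fin (n + 1) => jointLaw ρ η) i).integrable_comp
      hL.aestronglyMeasurable |>.2 hL).div_const _
  have hIT : Integrable (T.indicator fun _ => (1 : ℝ)) (sampleLaw ρ η n) :=
    (integrable_const _).indicator hTm
  calc ∫ s, ∑ i, weight x (fun j => (s j).1) i ^ 2 ∂(sampleLaw ρ η n)
      ≤ ∫ s, (T.indicator (fun _ => (1 : ℝ)) s + ∑ i, min (Z (s i)) A ^ 2 / A ^ 2)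
          ∂(sampleLaw ρ η n) := by
        refine integral_mono_of_nonneg (Eventually.of_forall fun s => by positivity)
          (hIT.add (integrable_finsetSum _ fun i _ => hLi i)) ?_
        filter_upwards [hx'] with s hs
        have h0 : 0 ≤ ∑ i, min (Z (s i)) A ^ 2 / A ^ 2 := by positivity
        by_cases hsT : s ∈ T
        · rw [Set.indicator_of_mem hsT]
          have h1 : ∑ i, weight x (fun j => (s j).1) i ^ 2 ≤ 1 := by
            rw [← sum_weight x fun j => (s j).1]
            exact Finset.sum_le_sum fun i _ =>
              pow_le_of_le_one (weight_nonneg _ _ _) (weight_le_one _ _ _) two_ne_zero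
          linarith
        · rw [Set.indicator_of_notMem hsT, zero_add]
          have hS : A ≤ ∑ i, Z (s i) := not_lt.1 hsT
          refine Finset.sum_le_sum fun i _ => ?_
          rw [← div_pow]
          refine pow_le_pow_left₀ (weight_nonneg _ _ _) ?_ 2
          rw [le_div_iff₀ hA]
          -- Both `w_i ≤ 1` and `w_i ≤ Z_i / A` are used: together they produce the truncation at
          -- `A`, without which `Z_i²` need not be integrable.
          refine le_min ?_ (mul_le_of_le_one_left hA.le (weight_le_one _ _ _))
          rw [weight_of_forall_ne hs]
          calc Z (s i) / (∑ j, Z (s j)) * A ≤ Z (s i) / (∑ j, Z (s j)) * ∑ j, Z (s j) := by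
                have : 0 ≤ ∑ j, Z (s j) := hA.le.trans hS
                gcongr
            _ = Z (s i) := div_mul_cancel₀ _ (hA.trans_le hS).ne'
    _ = (sampleLaw ρ η n).real T + (n + 1) * ((∫ z, min (Z z) A ^ 2 ∂(jointLaw ρ η)) / A ^ 2) := by
        rw [integral_add hIT (integrable_finsetSum _ fun i _ => hLi i),
          integral_indicator_const _ hTm, integral_finsetSum _ fun i _ => hLi i]
        simp only [integral_div, sampleLaw, integral_comp_eval
          (μ := fun _ : Fin (n + 1) => jointLaw ρ η) hL.aestronglyMeasurable]
        simp
    _ ≤ (sampleLaw ρ η n).real T + (n + 1) * (2 * C * A / A ^ 2) := by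
        gcongr
        exact integral_min_sq_le hZ hZ0 hC hA.le htail
    _ = _ := by
        congr 2
        field_simp

/-! ### Small balls around `x` and the tail of the unnormalised weight -/

lemma measurePreserving_fst_jointLaw {ρ : EuclideanSpace ℝ (Fin d) → ℝ} (hρ : IsDensity ρ)
    (η : Kernel (EuclideanSpace ℝ (Fin d)) (Fin 2)) [IsMarkovKernel η] :
    MeasurePreserving Prod.fst (jointLaw ρ η)
      (volume.withDensity fun y => ENNReal.ofReal (ρ y)) := by
  have := isProbabilityMeasure_withDensity hρ
  exact ⟨measurable_fst, Measure.fst_compProd _ _⟩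

lemma ae_jointLaw_fst_ne (hd : 0 < d) {ρ : EuclideanSpace ℝ (Fin d) → ℝ} (hρ : IsDensity ρ)
    (η : Kernel (EuclideanSpace ℝ (Fin d)) (Fin 2)) [IsMarkovKernel η]
    (x : EuclideanSpace ℝ (Fin d)) : ∀ᵐ z ∂(jointLaw ρ η), z.1 ≠ x := by
  have : Nonempty (Fin d) := ⟨⟨0, hd⟩⟩
  exact (measurePreserving_fst_jointLaw hρ η).quasiMeasurePreserving.ae
    ((withDensity_absolutelyContinuous _ _).ae_le (Measure.ae_ne volume x))

/-- The centre drops out because `0 ^ (-d)` is `0` by convention for `d > 0`. Tails of the weight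
thus become masses of small balls, with volume proportional to `r ^ d = 1 / t`. -/
lemma setOf_lt_norm_sub_zpow (hd : 0 < d) (x : EuclideanSpace ℝ (Fin d)) {r : ℝ} (hr : 0 < r) :
    {y | (r ^ d)⁻¹ < ‖x - y‖ ^ (-(d : ℤ))} = Metric.ball x r \ {x} := by
  ext y
  simp only [Set.mem_ofPred_eq, zpow_neg, zpow_natCast, Set.mem_sdiff, Metric.mem_ball,
    Set.mem_singleton_iff, dist_comm y x, dist_eq_norm]
  by_cases hy : y = x
  · subst hy
    have : 0 ≤ r ^ d := by positivity
    simp [hd.ne', this]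
  · have hpos : 0 < ‖x - y‖ := norm_pos_iff.2 (sub_ne_zero.2 (Ne.symm hy))
    rw [inv_lt_inv₀ (by positivity) (by positivity),
      pow_lt_pow_iff_left₀ hpos.le hr.le hd.ne']
    simp [hy]

/-- Near a point where the density is continuous and positive, the unnormalised weight
`‖x - X‖ ^ (-d)` has tails of order exactly `1 / t`. -/
lemma exists_tail_bounds (hd : 0 < d) {ρ : EuclideanSpace ℝ (Fin d) → ℝ} (hρ : IsDensity ρ)
    (η : Kernel (EuclideanSpace ℝ (Fin d)) (Fin 2)) [IsMarkovKernel η]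
    {x : EuclideanSpace ℝ (Fin d)} (hx : 0 < ρ x) (hcont : ContinuousAt ρ x) :
    ∃ c C t₀ : ℝ, 0 < c ∧ 0 < C ∧ 0 < t₀ ∧
      (∀ t, 0 < t → (jointLaw ρ η).real {z | t < ‖x - z.1‖ ^ (-(d : ℤ))} ≤ C / t) ∧
      ∀ t, t₀ ≤ t → c / t ≤ (jointLaw ρ η).real {z | t < ‖x - z.1‖ ^ (-(d : ℤ))} := by
  have : Nonempty (Fin d) := ⟨⟨0, hd⟩⟩
  have := isProbabilityMeasure_withDensity hρ
  set μ := (volume : Measure (EuclideanSpace ℝ (Fin d))).withDensity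
    fun y => ENNReal.ofReal (ρ y) with hμ
  obtain ⟨r₀, hr₀, hball⟩ := Metric.eventually_nhds_iff_ball.1
    ((hcont.eventually (lt_mem_nhds (half_lt_self hx))).and
      (hcont.eventually (gt_mem_nhds (lt_two_mul_self hx))))
  set V : ℝ := (volume : Measure (EuclideanSpace ℝ (Fin d))).real (Metric.ball 0 1) with hV
  have hV0 : 0 < V := ENNReal.toReal_pos (Metric.measure_ball_pos _ _ one_pos).ne'
    measure_ball_lt_top.ne
  have hvol {r : ℝ} (hr : 0 < r) : (volume : Measure (EuclideanSpace ℝ (Fin d)))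
      (Metric.ball x r \ {x}) = ENNReal.ofReal (r ^ d * V) := by
    rw [measure_sdiff_null (measure_singleton x), Measure.addHaar_ball _ _ hr.le,
      ENNReal.ofReal_mul (by positivity), hV, ofReal_measureReal measure_ball_lt_top.ne]
    simp
  have hmeas (r : ℝ) : MeasurableSet (Metric.ball x r \ {x}) :=
    measurableSet_ball.diff (MeasurableSet.singleton x)
  have hlaw (t : ℝ) : (jointLaw ρ η).real {z | t < ‖x - z.1‖ ^ (-(d : ℤ))} =
      μ.real {y | t < ‖x - y‖ ^ (-(d : ℤ))} := by
    have h := (measurePreserving_fst_jointLaw hρ η).measureReal_preimage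
      (measurableSet_lt (measurable_const (a := t)) (measurable_norm_sub_zpow x)).nullMeasurableSet
    exact h
  have hroot {t : ℝ} (ht : 0 < t) : ∃ r, 0 < r ∧ t = (r ^ d)⁻¹ := by
    refine ⟨t⁻¹ ^ ((d : ℝ)⁻¹), by positivity, ?_⟩
    rw [Real.rpow_inv_natCast_pow (by positivity) hd.ne', inv_inv]
  -- On the ball of radius `r₀` the density lies between `ρ x / 2` and `2 * ρ x`. The extra `(r₀ ^
  -- d)⁻¹` in `C` makes `C / t ≥ 1` for larger radii, where nothing is known about the density.
  refine ⟨ρ x / 2 * V, 2 * ρ x * V + (r₀ ^ d)⁻¹, (r₀ ^ d)⁻¹, by positivity, by positivity,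
    by positivity, fun t ht => ?_, fun t ht => ?_⟩
  · obtain ⟨r, hr, rfl⟩ := hroot ht
    rw [hlaw, setOf_lt_norm_sub_zpow hd x hr, div_inv_eq_mul, add_mul]
    rcases le_or_gt r r₀ with h | h
    · have h1 : μ (Metric.ball x r \ {x}) ≤ ENNReal.ofReal (2 * ρ x * (r ^ d * V)) := by
        rw [hμ, withDensity_apply _ (hmeas r), ENNReal.ofReal_mul (by positivity), ← hvol hr,
          ← setLIntegral_const]
        exact setLIntegral_mono' (hmeas r) fun y hy => ENNReal.ofReal_le_ofReal
          (hball y (Metric.ball_subset_ball h hy.1)).2.le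
      have h2 := ENNReal.toReal_le_of_le_ofReal (by positivity) h1
      have h3 : 0 ≤ (r₀ ^ d)⁻¹ * r ^ d := by positivity
      calc _ ≤ _ := h2
        _ ≤ _ := by linarith
    · have h3 : 1 ≤ (r₀ ^ d)⁻¹ * r ^ d := by
        rw [inv_mul_eq_div, one_le_div (by positivity)]
        exact pow_le_pow_left₀ hr₀.le h.le d
      have h4 : 0 ≤ 2 * ρ x * V * r ^ d := by positivity
      calc _ ≤ (1 : ℝ) := measureReal_le_one
        _ ≤ _ := by linarith
  · obtain ⟨r, hr, rfl⟩ := hroot ((by positivity : 0 < (r₀ ^ d)⁻¹).trans_le ht)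
    rw [hlaw, setOf_lt_norm_sub_zpow hd x hr, div_inv_eq_mul]
    have h : r ≤ r₀ := by
      rwa [inv_le_inv₀ (by positivity) (by positivity),
        pow_le_pow_iff_left₀ hr.le hr₀.le hd.ne'] at ht
    have h1 : ENNReal.ofReal (ρ x / 2 * (r ^ d * V)) ≤ μ (Metric.ball x r \ {x}) := by
      rw [hμ, withDensity_apply _ (hmeas r), ENNReal.ofReal_mul (by positivity), ← hvol hr,
        ← setLIntegral_const]
      exact setLIntegral_mono' (hmeas r) fun y hy => ENNReal.ofReal_le_ofReal
        (hball y (Metric.ball_subset_ball h hy.1)).1.le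
    have h2 := (ENNReal.ofReal_le_iff_le_toReal (measure_ne_top _ _)).1 h1
    calc _ = ρ x / 2 * (r ^ d * V) := by ring
      _ ≤ _ := h2

/-! ### Bias, variance and deviation probabilities -/

/-- The bias given the data points is small as soon as the normalisation is large. -/
lemma abs_sum_weight_mul_regFun_sub_le
    (η : Kernel (EuclideanSpace ℝ (Fin d)) (Fin 2)) [IsMarkovKernel η]
    {x : EuclideanSpace ℝ (Fin d)} {xs : Fin (n + 1) → EuclideanSpace ℝ (Fin d)}
    (hxs : ∀ j, xs j ≠ x) {r e A : ℝ} (hr : 0 < r) (he : 0 ≤ e)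
    (hclose : ∀ y ∈ Metric.ball x r, |regFun η y - regFun η x| ≤ e) (hA : 0 < A)
    (hS : A ≤ ∑ j, ‖x - xs j‖ ^ (-(d : ℤ))) :
    |∑ i, weight x xs i * (regFun η (xs i) - regFun η x)| ≤ e + (n + 1) * ((r ^ d)⁻¹ / A) := by
  have hw := weight_nonneg x xs
  calc _ ≤ ∑ i, |weight x xs i * (regFun η (xs i) - regFun η x)| :=
        Finset.abs_sum_le_sum_abs _ _
    _ ≤ ∑ i, (weight x xs i * e + (r ^ d)⁻¹ / A) := by
        refine Finset.sum_le_sum fun i _ => ?_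
        rw [abs_mul, abs_of_nonneg (hw i)]
        have h0 : 0 ≤ (r ^ d)⁻¹ / A := by positivity
        by_cases h : xs i ∈ Metric.ball x r
        · have := mul_le_mul_of_nonneg_left (hclose _ h) (hw i)
          linarith
        · have h1 : |regFun η (xs i) - regFun η x| ≤ 1 := by
            have h1 := regFun_mem_Icc η (xs i)
            have h2 := regFun_mem_Icc η x
            rw [abs_le]
            constructor <;> linarith [h1.1, h1.2, h2.1, h2.2]
          have h2 : weight x xs i ≤ (r ^ d)⁻¹ / A := by
            rw [weight_of_forall_ne hxs, zpow_neg, zpow_natCast]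
            have : r ≤ ‖x - xs i‖ := by
              rw [← dist_eq_norm, dist_comm]
              exact not_lt.1 h
            gcongr
          have h3 := mul_le_of_le_one_right (hw i) h1
          have h4 := mul_nonneg (hw i) he
          linarith
    _ = _ := by
        rw [Finset.sum_add_distrib, ← Finset.sum_mul, sum_weight]
        simp

lemma estimator_sub_regFun_eq (η : Kernel (EuclideanSpace ℝ (Fin d)) (Fin 2))
    (s : Fin (n + 1) → EuclideanSpace ℝ (Fin d) × Fin 2) (x : EuclideanSpace ℝ (Fin d)) :
    estimator s x - regFun η x =
      ∑ i, weight x (fun j => (s j).1) i * noise η (s i) +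
        ∑ i, weight x (fun j => (s j).1) i * (regFun η (s i).1 - regFun η x) := by
  have h : regFun η x = ∑ i, weight x (fun j => (s j).1) i * regFun η x := by
    rw [← Finset.sum_mul, sum_weight, one_mul]
  conv_lhs => rw [h]
  rw [estimator, ← Finset.sum_sub_distrib, ← Finset.sum_add_distrib]
  refine Finset.sum_congr rfl fun i _ => ?_
  rw [noise]
  ring

/-- Bias-variance bound for the deviation probability of the estimator, given a lower bound `A`
on the normalisation. -/
lemma measureReal_le_abs_estimator_sub_le (hd : 0 < d) {ρ : EuclideanSpace ℝ (Fin d) → ℝ}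
    (hρ : IsDensity ρ) (η : Kernel (EuclideanSpace ℝ (Fin d)) (Fin 2)) [IsMarkovKernel η]
    {x : EuclideanSpace ℝ (Fin d)} {r δ A C : ℝ} (hr : 0 < r) (hδ : 0 < δ)
    (hclose : ∀ y ∈ Metric.ball x r, |regFun η y - regFun η x| ≤ δ / 4)
    (hA : 0 < A) (hbias : (n + 1) * ((r ^ d)⁻¹ / A) ≤ δ / 4) (hC : 0 ≤ C)
    (htail : ∀ t, 0 < t → (jointLaw ρ η).real {z | t < ‖x - z.1‖ ^ (-(d : ℤ))} ≤ C / t) :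
    (sampleLaw ρ η n).real {s | δ ≤ |estimator s x - regFun η x|} ≤
      (sampleLaw ρ η n).real {s | ∑ i, ‖x - (s i).1‖ ^ (-(d : ℤ)) < A} * (1 + (δ / 2)⁻¹ ^ 2) +
        (δ / 2)⁻¹ ^ 2 * ((n + 1) * (2 * C / A)) := by
  have := isProbabilityMeasure_jointLaw hρ η
  have := isProbabilityMeasure_sampleLaw hρ η n
  have hx := ae_jointLaw_fst_ne hd hρ η x
  have hx' : ∀ᵐ s ∂(sampleLaw ρ η n), ∀ j, (s j).1 ≠ x := by
    rw [ae_all_iff]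
    exact fun j => (measurePreserving_eval (fun _ : Fin (n + 1) =>
      jointLaw ρ η) j).quasiMeasurePreserving.ae hx
  set D : (Fin (n + 1) → EuclideanSpace ℝ (Fin d) × Fin 2) → ℝ :=
    fun s => ∑ i, weight x (fun j => (s j).1) i * noise η (s i) with hD
  have hDm : Measurable D := Finset.measurable_sum _ fun i _ =>
    (measurable_weight_fst x i).mul ((measurable_noise η).comp (measurable_pi_apply i))
  have hDi : Integrable (fun s => D s ^ 2) (sampleLaw ρ η n) := by
    refine Integrable.of_bound (hDm.pow_const 2).aestronglyMeasurable 1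
      (Eventually.of_forall fun s => ?_)
    rw [norm_pow]
    refine pow_le_one₀ (norm_nonneg _) ((Finset.abs_sum_le_sum_abs _ _).trans ?_)
    rw [← sum_weight x fun j => (s j).1]
    refine Finset.sum_le_sum fun i _ => ?_
    rw [abs_mul, abs_of_nonneg (weight_nonneg _ _ _)]
    exact mul_le_of_le_one_right (weight_nonneg _ _ _) (abs_noise_le_one η _)
  have hvar : ∫ s, D s ^ 2 ∂(sampleLaw ρ η n) ≤ _ :=
    (integral_sum_weight_mul_noise_sq_le hρ η x).trans
      (integral_sum_weight_sq_le hρ η x hx hA hC htail)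
  have hcheb : (sampleLaw ρ η n).real {s | (δ / 2) ^ 2 ≤ D s ^ 2} ≤
      (δ / 2)⁻¹ ^ 2 * ∫ s, D s ^ 2 ∂(sampleLaw ρ η n) := by
    rw [inv_pow, le_inv_mul_iff₀ (by positivity)]
    exact mul_meas_ge_le_integral_of_nonneg (Eventually.of_forall fun s => sq_nonneg _) hDi _
  have hsub : (sampleLaw ρ η n).real {s | δ ≤ |estimator s x - regFun η x|} ≤
      (sampleLaw ρ η n).real ({s | ∑ i, ‖x - (s i).1‖ ^ (-(d : ℤ)) < A} ∪
        {s | (δ / 2) ^ 2 ≤ D s ^ 2}) := by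
    refine ENNReal.toReal_mono (measure_ne_top _ _) (measure_mono_ae ?_)
    filter_upwards [hx'] with s hs hdev
    by_cases hS : ∑ i, ‖x - (s i).1‖ ^ (-(d : ℤ)) < A
    · exact Or.inl hS
    · refine Or.inr ?_
      have hdev' : δ ≤ |estimator s x - regFun η x| := hdev
      rw [estimator_sub_regFun_eq] at hdev'
      have h1 := hdev'.trans (abs_add_le _ _)
      have h2 := abs_sum_weight_mul_regFun_sub_le η hs hr (by positivity) hclose hA
        (not_lt.1 hS)
      have h3 : δ / 2 ≤ |D s| := by linarith
      change (δ / 2) ^ 2 ≤ D s ^ 2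
      rw [← sq_abs (D s)]
      exact pow_le_pow_left₀ (by positivity) h3 2
  calc _ ≤ _ := hsub
    _ ≤ _ := measureReal_union_le _ _
    _ ≤ _ := add_le_add_right (hcheb.trans (mul_le_mul_of_nonneg_left hvar (by positivity))) _
    _ = _ := by ring

/-- At a continuity point, deviation probabilities of the Hilbert kernel estimator are
`O(1 / log n)`. -/
lemma exists_measureReal_le_abs_estimator_sub_le_div_log (hd : 0 < d)
    {ρ : EuclideanSpace ℝ (Fin d) → ℝ} (hρ : IsDensity ρ)
    (η : Kernel (EuclideanSpace ℝ (Fin d)) (Fin 2)) [IsMarkovKernel η]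
    {x : EuclideanSpace ℝ (Fin d)} (hx : 0 < ρ x) (hcont : ContinuousAt ρ x)
    (hf : ContinuousAt (regFun η) x) {δ : ℝ} (hδ : 0 < δ) :
    ∃ K : ℝ, ∀ᶠ n : ℕ in atTop,
      (sampleLaw ρ η n).real {s | δ ≤ |estimator s x - regFun η x|} ≤ K / Real.log n := by
  obtain ⟨c, C, t₀, hc, hC, ht₀, hup, hlo⟩ := exists_tail_bounds hd hρ η hx hcont
  have := isProbabilityMeasure_jointLaw hρ η
  obtain ⟨r, hr, hclose⟩ := Metric.continuousAt_iff.1 hf (δ / 4) (by positivity)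
  have hlog : Tendsto (fun n : ℕ => Real.log n) atTop atTop :=
    Real.tendsto_log_atTop.comp tendsto_natCast_atTop_atTop
  have hZ : Measurable fun z : EuclideanSpace ℝ (Fin d) × Fin 2 => ‖x - z.1‖ ^ (-(d : ℤ)) :=
    (measurable_norm_sub_zpow x).comp measurable_fst
  set g : ℝ := (δ / 2)⁻¹ ^ 2 with hg
  have hg0 : 0 < g := by positivity
  refine ⟨(8 * C * (1 + g) + g * (4 * C)) * (2 / c), ?_⟩
  -- In order, these ensure `b ≥ c / 2 * log n`, `b ≥ 1`, a bias from far points of at most `δ / 4`,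
  -- positivity of `n`, and a truncation level of at least `t₀`.
  filter_upwards [hlog.eventually_ge_atTop (2 * Real.log t₀), hlog.eventually_ge_atTop (2 / c),
    hlog.eventually_ge_atTop (2 / c * (8 * (r ^ d)⁻¹ / δ)), eventually_ge_atTop 1,
    tendsto_natCast_atTop_atTop.eventually_ge_atTop t₀] with n h1 h2 h3 hn hnt
  set L := Real.log n with hL
  have hL0 : 0 < L := lt_of_lt_of_le (by positivity) h2
  set b : ℝ := c * Real.log ((n + 1 : ℝ) / t₀) with hb
  have hbL : c / 2 * L ≤ b := by
    rw [hb, Real.log_div (by positivity) ht₀.ne']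
    have : L ≤ Real.log (n + 1 : ℝ) := Real.log_le_log (by positivity) (by linarith)
    have : L / 2 ≤ Real.log (n + 1 : ℝ) - Real.log t₀ := by linarith
    calc c / 2 * L = c * (L / 2) := by ring
      _ ≤ _ := by gcongr
  have hscale {a : ℝ} (h : 2 / c * a ≤ L) : a ≤ b := by
    calc a = c / 2 * (2 / c * a) := by field_simp
      _ ≤ c / 2 * L := by gcongr
      _ ≤ b := hbL
  have hb1 : 1 ≤ b := hscale (by simpa using h2)
  have hb0 : 0 < b := by linarith
  -- Truncating at the sample size cancels `n + 1` in the Chebyshev bound, leaving `8 * C / b ^ 2`;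
  -- this is weakened to `8 * C / b` below, since the noise term is `O(1 / b)` anyway.
  have hsum := pi_measureReal_sum_lt_le (ν := jointLaw ρ η) (ι := Fin (n + 1)) hZ
    (fun z => by positivity) (M := n + 1) hC.le (by positivity) hb0 hup
    (mul_log_le_integral_min hZ (fun z => by positivity) hc.le ht₀ (by linarith) hlo)
  have hA : 0 < (n + 1 : ℝ) * b / 2 := by positivity
  have hdev := measureReal_le_abs_estimator_sub_le (n := n) hd hρ η hr hδ
    (fun y hy => (hclose hy).le) hA ?_ hC.le hup
  · simp only [Fintype.card_fin, Nat.cast_add, Nat.cast_one] at hsum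
    have hsum' : (sampleLaw ρ η n).real
        {s | ∑ i, ‖x - (s i).1‖ ^ (-(d : ℤ)) < (n + 1 : ℝ) * b / 2} ≤ 8 * C / b := by
      refine hsum.trans ?_
      calc 8 * C * (n + 1 : ℝ) / ((n + 1 : ℝ) * b ^ 2) = 8 * C / (b * b) := by
            field_simp
        _ ≤ 8 * C / (b * 1) := by gcongr
        _ = _ := by rw [mul_one]
    calc _ ≤ _ := hdev
      _ ≤ 8 * C / b * (1 + g) + g * ((n + 1) * (2 * C / ((n + 1 : ℝ) * b / 2))) := by
          gcongr
      _ = (8 * C * (1 + g) + g * (4 * C)) / b := by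
          field_simp
          ring
      _ ≤ (8 * C * (1 + g) + g * (4 * C)) / (c / 2 * L) := by gcongr
      _ = _ := by field_simp
  · have h4 : 8 * (r ^ d)⁻¹ / δ ≤ b := hscale h3
    rw [div_le_iff₀ hδ] at h4
    calc (n + 1 : ℝ) * ((r ^ d)⁻¹ / ((n + 1 : ℝ) * b / 2)) = 2 * (r ^ d)⁻¹ / b := by
          field_simp
      _ ≤ δ / 4 := by
          rw [div_le_iff₀ hb0]
          linarith

/-- The disagreement probability with the Bayes classifier, times `|f x - 1/2|`,
is `O(1 / log n)`. -/
lemma exists_mul_measureReal_plugin_ne_le_div_log (hd : 0 < d) (v : Fin 2)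
    {ρ : EuclideanSpace ℝ (Fin d) → ℝ} (hρ : IsDensity ρ)
    (η : Kernel (EuclideanSpace ℝ (Fin d)) (Fin 2)) [IsMarkovKernel η]
    {x : EuclideanSpace ℝ (Fin d)} (hx : 0 < ρ x) (hcont : ContinuousAt ρ x)
    (hf : ContinuousAt (regFun η) x) :
    ∃ K : ℝ, ∀ᶠ n : ℕ in atTop, |regFun η x - 1 / 2| *
      (sampleLaw ρ η n).real {s | plugin v s x ≠ bayesClassifier v η x} ≤ K / Real.log n := by
  -- For `f x = 1/2` there is no positive deviation threshold, but the factor in front vanishes.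
  rcases (abs_nonneg (regFun η x - 1 / 2)).eq_or_lt with h0 | h0
  · exact ⟨0, Eventually.of_forall fun n => by rw [← h0]; simp⟩
  · obtain ⟨K, hK⟩ := exists_measureReal_le_abs_estimator_sub_le_div_log hd hρ η hx hcont hf h0
    refine ⟨|regFun η x - 1 / 2| * K, ?_⟩
    filter_upwards [hK] with n hn
    have := isProbabilityMeasure_sampleLaw hρ η n
    rw [mul_div_assoc]
    refine mul_le_mul_of_nonneg_left (le_trans (measureReal_mono fun s hs => ?_) hn) h0.le
    exact abs_regFun_sub_half_le_of_plugin_ne hs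

end HilbertKernel

/-! ### The theorem -/

theorem theorem9 {d : ℕ} (hd : 0 < d)
    (ρ : EuclideanSpace ℝ (Fin d) → ℝ) (hρ : HilbertKernel.IsDensity ρ)
    (η : ProbabilityTheory.Kernel (EuclideanSpace ℝ (Fin d)) (Fin 2))
    [ProbabilityTheory.IsMarkovKernel η] (v : Fin 2) :
    (∀ (x : EuclideanSpace ℝ (Fin d)) (n : ℕ) (α : ℝ), 0 < α → α < 1 →
      HilbertKernel.excessRisk v ρ η n x ≤
        2 * |HilbertKernel.regFun η x - 1 / 2| ^ (1 - α) *
          HilbertKernel.regressionRisk ρ η n x ^ (α / 2)) ∧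
    (∀ x ∈ interior (HilbertKernel.densitySupport ρ),
      0 < HilbertKernel.condStd η x →
      ContinuousAt ρ x →
      ContinuousAt (HilbertKernel.condStd η) x →
      ContinuousAt (HilbertKernel.regFun η) x →
      Tendsto (fun n : ℕ => HilbertKernel.excessRisk v ρ η n x) atTop (𝓝 0) ∧
      ∀ ε : ℝ, 0 < ε → ∃ N : ℕ, ∀ n : ℕ, N ≤ n →
        (0 ≤ HilbertKernel.excessRisk v ρ η n x ∧
          HilbertKernel.excessRisk v ρ η n x ≤
            2 * (1 + ε) * (HilbertKernel.condStd η x / Real.sqrt (Real.log n))) ∧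
        ∀ α : ℝ, 0 < α → α < 1 →
          0 ≤ HilbertKernel.excessRisk v ρ η n x ∧
          HilbertKernel.excessRisk v ρ η n x ≤
            2 * |HilbertKernel.regFun η x - 1 / 2| ^ (1 - α) * (1 + ε) ^ α *
              (HilbertKernel.condStd η x ^ α / Real.log n ^ (α / 2))) := by
  refine ⟨fun x n α hα hα1 => HilbertKernel.excessRisk_le_regressionRisk v hρ η n x hα hα1, ?_⟩
  intro x hx hσ hcont _ hf
  obtain ⟨K, hK⟩ := HilbertKernel.exists_mul_measureReal_plugin_ne_le_div_log hd v hρ η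
    (interior_subset (s := HilbertKernel.densitySupport ρ) hx) hcont hf
  have h0 (n : ℕ) := HilbertKernel.excessRisk_nonneg v hρ η n x
  have hlog : Tendsto (fun n : ℕ => Real.log n) atTop atTop :=
    Real.tendsto_log_atTop.comp tendsto_natCast_atTop_atTop
  refine ⟨?_, fun ε hε => ?_⟩
  · refine squeeze_zero' (Eventually.of_forall h0) (g := fun n : ℕ => 2 * (K / Real.log n)) ?_ ?_
    · filter_upwards [hK] with n hn
      rw [HilbertKernel.excessRisk_eq v hρ, mul_assoc]
      linarith
    · simpa using (hlog.const_div_atTop K).const_mul 2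
  set σ := HilbertKernel.condStd η x with hσdef
  have hsqrt : Tendsto (fun n : ℕ => Real.sqrt (Real.log n)) atTop atTop :=
    Real.tendsto_sqrt_atTop.comp hlog
  refine eventually_atTop.1 ?_
  -- The last condition is `K / log n ≤ q` rearranged. It does not involve `α`, so one `N` serves
  -- every exponent.
  filter_upwards [hK, hlog.eventually_gt_atTop 0,
    hsqrt.eventually_ge_atTop (K / ((1 + ε) * σ))] with n hn hL hroot
  have hs : 0 < Real.sqrt (Real.log n) := Real.sqrt_pos.2 hL
  set q : ℝ := (1 + ε) * (σ / Real.sqrt (Real.log n)) with hq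
  have hKq : K / Real.log n ≤ q := by
    rw [div_le_iff₀ (by positivity)] at hroot
    calc K / Real.log n ≤ Real.sqrt (Real.log n) * ((1 + ε) * σ) / Real.log n := by gcongr
      _ = Real.sqrt (Real.log n) * ((1 + ε) * σ) /
          (Real.sqrt (Real.log n) * Real.sqrt (Real.log n)) := by rw [Real.mul_self_sqrt hL.le]
      _ = q := by rw [hq]; field_simp
  refine ⟨⟨h0 n, ?_⟩, fun α hα hα1 => ⟨h0 n, ?_⟩⟩
  · rw [HilbertKernel.excessRisk_eq v hρ, mul_assoc, mul_assoc]
    exact mul_le_mul_of_nonneg_left (hn.trans hKq) zero_le_two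
  · have := HilbertKernel.isProbabilityMeasure_sampleLaw hρ η n
    have key := HilbertKernel.excessRisk_le_of_measureReal_le v hρ η n (x := x) (q := q) hα ?_
    · rw [hq, Real.mul_rpow (by positivity) (by positivity),
        Real.div_rpow hσ.le hs.le, Real.sqrt_eq_rpow, ← Real.rpow_mul hL.le,
        show (1 / 2 : ℝ) * α = α / 2 by ring, ← mul_assoc] at key
      exact key
    -- Since `1 / α ≥ 1`, a probability satisfies `P ^ (1 / α) ≤ P`, which reduces all exponents to
    -- the single bound on `D * P`.
    · refine le_trans (mul_le_mul_of_nonneg_left ?_ (abs_nonneg _)) (hn.trans hKq)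
      refine Real.rpow_le_self_of_le_one measureReal_nonneg measureReal_le_one ?_
      rw [le_div_iff₀ hα]
      linarith
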